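/- Let $X_p$ (primary nodes) and $X_s$ (secondary nodes) be independent homogeneous Poisson point processes in $\mathbb{R}^2$ with densities $\lambda_p\ge 0$ and $\lambda_s\ge 0$, and let $D_t,d_t,D_f\ge 0$. Two primary nodes $x,y\in X_p$ are linked if $\|x-y\|_2\le D_t$. Two secondary nodes $z,w\in X_s$ are linked if $\|z-w\|_2\le d_t$ and there is no primary node $x\in X_p$ with $\|x-z\|_2\le D_f$ or $\|x-w\|_2\le D_f$. The connected component of a node of a network is the set of all nodes of that network which can be reached from it by a finite path with linked consecutive nodes; it is called unbounded if it contains infinitely many nodes. Let $\mathcal{C}$ be the set of all 5-tuples $(D_t,d_t,D_f,\lambda_p,\lambda_s)\in[0,\infty)^5$ for which, almost surely, both the primary and the secondary network contain at least one unbounded connected component. For fixed values of the parameters in brackets, let $\mathcal{C}(D_t)\subseteq[0,\infty)^4$, $\mathcal{C}(D_t,d_t)\subseteq[0,\infty)^3$ and $\mathcal{C}(D_t,d_t,D_f)\subseteq[0,\infty)^2$ be the corresponding sections of $\mathcal{C}$, that is, the sets of those tuples $(d_t,D_f,\lambda_p,\lambda_s)$, triples $(D_f,\lambda_p,\lambda_s)$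 and pairs $(\lambda_p,\lambda_s)$, respectively, for which $(D_t,d_t,D_f,\lambda_p,\lambda_s)\in\mathcal{C}$. Then $\mathcal{C}$ is a connected set, and for all $D_t,d_t,D_f\ge 0$ the sections $\mathcal{C}(D_t,d_t,D_f)$, $\mathcal{C}(D_t,d_t)$ and $\mathcal{C}(D_t)$ are connected sets (the empty set counts as connected). -/

import Mathlib

open MeasureTheory ProbabilityTheory
open scoped NNReal

/-- The plane `ℝ²` with its `L²` norm. -/
abbrev Plane : Type := EuclideanSpace ℝ (Fin 2)

/-- A node configuration: a locally finite set of points of the plane. Such a set is the same thing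
as a simple (locally finite) counting measure on the plane, namely `A ↦ #(nodes ∩ A)`. -/
structure Configuration : Type where
  nodes : Set Plane
  locallyFinite : ∀ r : ℝ, (nodes ∩ Metric.closedBall 0 r).Finite

/-- The number of nodes of `ω` in `A`. -/
noncomputable def Configuration.count (ω : Configuration) (A : Set Plane) : ℕ∞ :=
  (ω.nodes ∩ A).encard

/-- The σ-algebra on configurations generated by the sets `{ω | ω(A) = k}`, `A` Borel, `k ∈ ℕ`. -/
instance Configuration.instMeasurableSpace : MeasurableSpace Configuration :=
  MeasurableSpace.generateFrom
    {S | ∃ (A : Set Plane) (k : ℕ), MeasurableSet A ∧ S = {ω : Configuration | ω.count A = k}}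

/-- `X` is, under `P`, a homogeneous Poisson point process in the plane with density `lam`:
the number of points in a bounded Borel set `A` is Poisson distributed with mean `lam * |A|`, and
the numbers of points in finitely many pairwise disjoint bounded Borel sets are independent. -/
structure IsPoissonPointProcess {Ω : Type} [MeasurableSpace Ω] (P : Measure Ω)
    (X : Ω → Configuration) (lam : ℝ≥0) : Prop where
  measurable : Measurable X
  poisson : ∀ A : Set Plane, MeasurableSet A → Bornology.IsBounded A → ∀ k : ℕ,
    P {ω | (X ω).count A = k} = poissonMeasure (lam * (volume A).toNNReal) {k}
  indep : ∀ (n : ℕ) (A : Fin n → Set Plane), (∀ i, MeasurableSet (A i)) →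
    (∀ i, Bornology.IsBounded (A i)) → Pairwise (fun i j => Disjoint (A i) (A j)) →
    iIndepFun (fun i ω => (X ω).count (A i)) P

/-- There is a communication opportunity from the node `x` to the node `y` of the primary
network `ωp`. -/
def PrimaryOpportunity (Dt : ℝ≥0) (ωp : Configuration) (x y : Plane) : Prop :=
  x ∈ ωp.nodes ∧ y ∈ ωp.nodes ∧ ‖x - y‖ ≤ Dt

/-- There is a communication opportunity from the node `z` to the node `w` of the secondary
network `ωs`, in the presence of the primary nodes `ωp`. -/
def SecondaryOpportunity (dt Df : ℝ≥0) (ωp ωs : Configuration) (z w : Plane) : Prop :=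
  z ∈ ωs.nodes ∧ w ∈ ωs.nodes ∧ ‖z - w‖ ≤ dt ∧
    (¬ ∃ x ∈ ωp.nodes, ‖x - z‖ ≤ Df) ∧ (¬ ∃ x ∈ ωp.nodes, ‖x - w‖ ≤ Df)

/-- The link between two nodes: there are communication opportunities both ways. -/
def Link (opp : Plane → Plane → Prop) (x y : Plane) : Prop := opp x y ∧ opp y x

/-- The connected component of the node `x`: all nodes of `ω` joined to `x` by a finite path
of nodes in which any two consecutive nodes are linked. -/
def nodeComponent (ω : Configuration) (opp : Plane → Plane → Prop) (x : Plane) : Set Plane :=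
  {y | y ∈ ω.nodes ∧ Relation.ReflTransGen (Link opp) x y}

/-- There is an unbounded connected component, i.e. one with infinitely many nodes. -/
def HasUnboundedComponent (ω : Configuration) (opp : Plane → Plane → Prop) : Prop :=
  ∃ x ∈ ω.nodes, (nodeComponent ω opp x).Infinite

/-- For two independent Poisson point processes with densities `lamp` (primary nodes) and `lams`
(secondary nodes), both networks contain almost surely an unbounded connected component. This is a
property of the joint law of the two processes only, so it does not matter on which probability
space they are realized. -/
def SimultaneouslyConnected (Dt dt Df lamp lams : ℝ≥0) : Prop :=
  ∀ (Ω : Type) [MeasurableSpace Ω] (P : Measure Ω) [IsProbabilityMeasure P]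
    (Xp Xs : Ω → Configuration),
    IsPoissonPointProcess P Xp lamp → IsPoissonPointProcess P Xs lams → IndepFun Xp Xs P →
    ∀ᵐ ω ∂P, HasUnboundedComponent (Xp ω) (PrimaryOpportunity Dt (Xp ω)) ∧
      HasUnboundedComponent (Xs ω) (SecondaryOpportunity dt Df (Xp ω) (Xs ω))

/-- The region `𝒞` of 5-tuples `(D_t, d_t, D_f, λ_p, λ_s)`. -/
def connectivityRegion : Set (ℝ≥0 × ℝ≥0 × ℝ≥0 × ℝ≥0 × ℝ≥0) :=
  {q | SimultaneouslyConnected q.1 q.2.1 q.2.2.1 q.2.2.2.1 q.2.2.2.2}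

/-- The region `𝒞(D_t)` of 4-tuples `(d_t, D_f, λ_p, λ_s)`. -/
def connectivityRegion₁ (Dt : ℝ≥0) : Set (ℝ≥0 × ℝ≥0 × ℝ≥0 × ℝ≥0) :=
  {q | SimultaneouslyConnected Dt q.1 q.2.1 q.2.2.1 q.2.2.2}

/-- The region `𝒞(D_t, d_t)` of triples `(D_f, λ_p, λ_s)`. -/
def connectivityRegion₂ (Dt dt : ℝ≥0) : Set (ℝ≥0 × ℝ≥0 × ℝ≥0) :=
  {q | SimultaneouslyConnected Dt dt q.1 q.2.1 q.2.2}

/-- The region `𝒞(D_t, d_t, D_f)` of pairs `(λ_p, λ_s)`. -/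
def connectivityRegion₃ (Dt dt Df : ℝ≥0) : Set (ℝ≥0 × ℝ≥0) :=
  {q | SimultaneouslyConnected Dt dt Df q.1 q.2}

/-! Membership in the region is preserved when `Dt`, `dt` or `lams` grows and when `Df` shrinks. The
primary density `lamp` has opposite effects: more primary nodes help the primary network and block
secondary links. With the other parameters fixed, the admissible values of `lamp` nevertheless form
an interval: between two of them, the primary network inherits an unbounded component from the
smaller value and the secondary network from the larger one (`of_primaryDensity_between`). Two
points of the region are therefore joined inside it: move both, at their own `lamp`, to the same
best values of the other four parameters, then vary `lamp` alone.

Densities are compared by coupling on a product space. Independent thinning lowers a density and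
independent superposition raises it; since `SimultaneouslyConnected` speaks of all probability
spaces, it applies to the coupled processes. The process superposed is a dilated independent copy of
the given one, so no existence theorem for Poisson processes is needed.

Both constructions are shown to be Poisson through `of_fiberwise`, which reduces the claim to an
identity for one set: a binomial mixture of Poisson laws for thinning, a convolution of Poisson laws
for superposition. Marks for thinning are attached to nodes by a measurable labelling. -/

namespace Configuration

/-! ### Counts and local finiteness -/

lemma measurable_count {A : Set Plane} (hA : MeasurableSet A) :
    Measurable fun ω : Configuration => ω.count A :=
  ENat.measurable_iff.2 fun n => MeasurableSpace.measurableSet_generateFrom ⟨A, n, hA, rfl⟩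

lemma measurable_of_count {α : Type*} [MeasurableSpace α] {f : α → Configuration}
    (h : ∀ A, MeasurableSet A → Measurable fun x => (f x).count A) : Measurable f := by
  refine measurable_generateFrom ?_
  rintro _ ⟨A, k, hA, rfl⟩
  exact h A hA (measurableSet_singleton _)

lemma finite_inter (ω : Configuration) {A : Set Plane} (hA : Bornology.IsBounded A) :
    (ω.nodes ∩ A).Finite := by
  obtain ⟨r, hr⟩ := hA.subset_closedBall 0
  exact (ω.locallyFinite r).subset (Set.inter_subset_inter_right _ hr)

lemma count_ne_top (ω : Configuration) {A : Set Plane} (hA : Bornology.IsBounded A) :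
    ω.count A ≠ ⊤ :=
  Set.encard_ne_top_iff.2 (ω.finite_inter hA)

lemma countable_nodes (ω : Configuration) : ω.nodes.Countable := by
  have : ω.nodes = ⋃ n : ℕ, ω.nodes ∩ Metric.closedBall 0 n := by
    rw [← Set.inter_iUnion, Metric.iUnion_closedBall_nat, Set.inter_univ]
  rw [this]
  exact Set.countable_iUnion fun n => (ω.locallyFinite n).countable

end Configuration

/-! ### Criteria for being a Poisson point process -/

namespace IsPoissonPointProcess

variable {Ω : Type} [MeasurableSpace Ω] {P : Measure Ω} {X : Ω → Configuration} {lam : ℝ≥0}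

lemma map_toNat_count (hX : IsPoissonPointProcess P X lam) {A : Set Plane} (hA : MeasurableSet A)
    (hb : Bornology.IsBounded A) :
    P.map (fun ω => ((X ω).count A).toNat) = poissonMeasure (lam * (volume A).toNNReal) := by
  have hm : Measurable fun ω => (X ω).count A := (Configuration.measurable_count hA).comp hX.measurable
  refine Measure.ext_of_singleton fun k => ?_
  have hm' : Measurable fun ω => ((X ω).count A).toNat := (measurable_of_countable _).comp hm
  rw [Measure.map_apply hm' (measurableSet_singleton _), ← hX.poisson A hA hb k]
  congr 1
  ext ω
  have := (X ω).count_ne_top hb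
  lift (X ω).count A to ℕ using this with m hm'
  simp [← hm']

/-- A measurable map into configurations is a Poisson point process as soon as the numbers of
points in disjoint bounded Borel sets have the right joint mass function. -/
lemma of_joint [IsProbabilityMeasure P] (hX : Measurable X)
    (h : ∀ (n : ℕ) (A : Fin n → Set Plane), (∀ i, MeasurableSet (A i)) →
      (∀ i, Bornology.IsBounded (A i)) → Pairwise (fun i j => Disjoint (A i) (A j)) →
      ∀ k : Fin n → ℕ, P {ω | ∀ i, (X ω).count (A i) = k i} =
        ∏ i, poissonMeasure (lam * (volume (A i)).toNNReal) {k i}) :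
    IsPoissonPointProcess P X lam := by
  have hP : ∀ A : Set Plane, MeasurableSet A → Bornology.IsBounded A → ∀ k : ℕ,
      P {ω | (X ω).count A = k} = poissonMeasure (lam * (volume A).toNNReal) {k} := by
    intro A hA hb k
    simpa using h 1 (fun _ => A) (fun _ => hA) (fun _ => hb)
      (fun i j hij => (hij (Subsingleton.elim i j)).elim) (fun _ => k)
  refine ⟨hX, hP, fun n A hA hb hd => ?_⟩
  have hm : ∀ i, Measurable fun ω => (X ω).count (A i) := fun i =>
    (Configuration.measurable_count (hA i)).comp hX
  rw [iIndepFun_iff_map_fun_eq_pi_map fun i => (hm i).aemeasurable]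
  refine Measure.ext_of_singleton fun k => ?_
  rw [Measure.map_apply (measurable_pi_lambda _ hm) (measurableSet_singleton _),
    Measure.pi_singleton]
  simp_rw [fun i => Measure.map_apply (μ := P) (hm i) (measurableSet_singleton (k i))]
  have hset : (fun ω i => (X ω).count (A i)) ⁻¹' {k} = {ω | ∀ i, (X ω).count (A i) = k i} := by
    ext ω; simp [funext_iff]
  rw [hset]
  -- Bounded sets contain finitely many nodes, so a vector with an infinite entry has mass zero on
  -- both sides.
  by_cases hk : ∀ i, k i ≠ ⊤
  · lift k to Fin n → ℕ using hk
    rw [h n A hA hb hd k]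
    refine Finset.prod_congr rfl fun i _ => ?_
    rw [← hP (A i) (hA i) (hb i) (k i)]
    rfl
  · push Not at hk
    obtain ⟨i, hi⟩ := hk
    rw [Finset.prod_eq_zero (Finset.mem_univ i)]
    · convert measure_empty (μ := P)
      refine Set.eq_empty_of_forall_notMem fun ω hω => (X ω).count_ne_top (hb i) ?_
      rw [hω i, hi]
    · convert measure_empty (μ := P)
      refine Set.eq_empty_of_forall_notMem fun ω hω => (X ω).count_ne_top (hb i) ?_
      exact (show (X ω).count (A i) = k i from hω).trans hi

/-- If, conditionally on `X`, the numbers of points of `Y` in disjoint sets are independent, with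
a law depending only on the number of points of `X` in the same set, and if this turns the Poisson
laws with density `lam` into those with density `mu`, then `Y` is a Poisson point process. -/
lemma of_fiberwise [IsProbabilityMeasure P] {Ω' : Type} [MeasurableSpace Ω'] {Q : Measure Ω'}
    [IsProbabilityMeasure Q] {mu : ℝ≥0} {Y : Ω × Ω' → Configuration}
    (hX : IsPoissonPointProcess P X lam) (hY : Measurable Y)
    (h : Set Plane → ℕ → ℕ → ENNReal)
    (hfib : ∀ (n : ℕ) (A : Fin n → Set Plane), (∀ i, MeasurableSet (A i)) →
      (∀ i, Bornology.IsBounded (A i)) → Pairwise (fun i j => Disjoint (A i) (A j)) →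
      ∀ (k : Fin n → ℕ) (ω : Ω), Q {ω' | ∀ i, (Y (ω, ω')).count (A i) = k i} =
        ∏ i, h (A i) ((X ω).count (A i)).toNat (k i))
    (hsum : ∀ A : Set Plane, MeasurableSet A → Bornology.IsBounded A → ∀ k : ℕ,
      ∫⁻ m, h A m k ∂poissonMeasure (lam * (volume A).toNNReal) =
        poissonMeasure (mu * (volume A).toNNReal) {k}) :
    IsPoissonPointProcess (P.prod Q) Y mu := by
  refine of_joint hY fun n A hA hb hd k => ?_
  have hms : MeasurableSet {z | ∀ i, (Y z).count (A i) = k i} := by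
    rw [Set.ofPred_forall]
    exact MeasurableSet.iInter fun i =>
      ((Configuration.measurable_count (hA i)).comp hY) (measurableSet_singleton _)
  have hm : ∀ i, Measurable fun ω => (X ω).count (A i) := fun i =>
    (Configuration.measurable_count (hA i)).comp hX.measurable
  have hm' : ∀ i, Measurable fun ω => ((X ω).count (A i)).toNat := fun i =>
    (measurable_of_countable ENat.toNat).comp (hm i)
  rw [Measure.prod_apply hms]
  simp_rw [Set.preimage_ofPred_eq, hfib n A hA hb hd k]
  -- After Fubini the integrand is a product of functions of the counts of `X`, which are
  -- independent.
  rw [lintegral_prod_eq_prod_lintegral_of_indepFun Finset.univ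
    (fun i ω => h (A i) ((X ω).count (A i)).toNat (k i))
    ((hX.indep n A hA hb hd).comp (fun i m => h (A i) m.toNat (k i))
      fun i => measurable_of_countable _)
    fun i => (measurable_of_countable fun m => h (A i) m (k i)).comp (hm' i)]
  refine Finset.prod_congr rfl fun i _ => ?_
  rw [← hsum (A i) (hA i) (hb i) (k i), ← hX.map_toNat_count (hA i) (hb i),
    lintegral_map (measurable_of_countable _) (hm' i)]

end IsPoissonPointProcess

/-! ### Measurable labelling of nodes -/

lemma exists_planeBasis :
    ∃ c : ℕ → Set Plane, TopologicalSpace.IsTopologicalBasis (Set.range c) := by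
  have hb := TopologicalSpace.isBasis_countableBasis Plane
  obtain ⟨t, ht, -⟩ := hb.exists_subset_of_mem_open (Set.mem_univ (0 : Plane)) isOpen_univ
  obtain ⟨c, hc⟩ := (TopologicalSpace.countable_countableBasis Plane).exists_eq_range ⟨t, ht⟩
  exact ⟨c, hc ▸ hb⟩

/-- A sequence enumerating a basis of the topology of the plane. -/
noncomputable def planeBasis : ℕ → Set Plane := exists_planeBasis.choose

lemma isTopologicalBasis_planeBasis :
    TopologicalSpace.IsTopologicalBasis (Set.range planeBasis) := exists_planeBasis.choose_spec

lemma measurableSet_planeBasis (i : ℕ) : MeasurableSet (planeBasis i) :=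
  (isTopologicalBasis_planeBasis.isOpen ⟨i, rfl⟩).measurableSet

namespace Configuration

/-- By local finiteness, deleting the other nodes from a ball around the origin that contains `x`
leaves an open set. -/
lemma exists_planeBasis_inter_eq (ω : Configuration) {x : Plane} (hx : x ∈ ω.nodes) :
    ∃ i, ω.nodes ∩ planeBasis i = {x} := by
  have hfin : ((ω.nodes ∩ Metric.closedBall 0 (‖x‖ + 1)) \ {x}).Finite :=
    (ω.locallyFinite _).subset Set.sdiff_subset
  have hU : IsOpen (Metric.ball 0 (‖x‖ + 1) \ ((ω.nodes ∩ Metric.closedBall 0 (‖x‖ + 1)) \ {x})) :=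
    Metric.isOpen_ball.sdiff hfin.isClosed
  have hxU : x ∈ Metric.ball 0 (‖x‖ + 1) \ ((ω.nodes ∩ Metric.closedBall 0 (‖x‖ + 1)) \ {x}) :=
    ⟨by simp, fun h => h.2 rfl⟩
  obtain ⟨_, ⟨i, rfl⟩, hxi, hi⟩ := isTopologicalBasis_planeBasis.exists_subset_of_mem_open
    hxU hU
  refine ⟨i, Set.Subset.antisymm (fun y hy => ?_) (by rintro _ rfl; exact ⟨hx, hxi⟩)⟩
  by_contra hne
  have := hi hy.2
  exact this.2 ⟨⟨hy.1, Metric.ball_subset_closedBall this.1⟩, hne⟩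

/-- The least index of a basis set whose only node is `x`. -/
noncomputable def label (ω : Configuration) (x : Plane) : ℕ :=
  sInf {i | ω.nodes ∩ planeBasis i = {x}}

lemma inter_planeBasis_label (ω : Configuration) {x : Plane} (hx : x ∈ ω.nodes) :
    ω.nodes ∩ planeBasis (ω.label x) = {x} :=
  Nat.sInf_mem (ω.exists_planeBasis_inter_eq hx)

lemma injOn_label (ω : Configuration) : Set.InjOn ω.label ω.nodes := by
  intro x hx y hy h
  have := ω.inter_planeBasis_label hx
  rw [h, ω.inter_planeBasis_label hy] at this
  exact (Set.singleton_injective this).symm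

/-- The labels of the nodes in `A`. -/
def labels (ω : Configuration) (A : Set Plane) : Set ℕ := ω.label '' (ω.nodes ∩ A)

lemma encard_labels (ω : Configuration) (A : Set Plane) : (ω.labels A).encard = ω.count A :=
  (ω.injOn_label.mono Set.inter_subset_left).encard_image

lemma finite_labels (ω : Configuration) {A : Set Plane} (hA : Bornology.IsBounded A) :
    (ω.labels A).Finite :=
  (ω.finite_inter hA).image _

lemma disjoint_labels (ω : Configuration) {A B : Set Plane} (h : Disjoint A B) :
    Disjoint (ω.labels A) (ω.labels B) := by
  rw [Set.disjoint_left]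
  rintro _ ⟨x, hx, rfl⟩ ⟨y, hy, hyx⟩
  have := ω.injOn_label hy.1 hx.1 hyx
  subst this
  exact Set.disjoint_left.1 h hx.2 hy.2

/-- Expressing labels through counts alone makes `labels` measurable. The last clause says that no
earlier basis set isolates the same node: two sets with one node each share it exactly when their
intersection has one node. -/
lemma mem_labels_iff {ω : Configuration} {A : Set Plane} {i : ℕ} :
    i ∈ ω.labels A ↔ ω.count (planeBasis i) = 1 ∧ ω.count (planeBasis i ∩ A) = 1 ∧
      ∀ j < i, ¬ (ω.count (planeBasis j) = 1 ∧ ω.count (planeBasis i ∩ planeBasis j) = 1) := by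
  constructor
  · rintro ⟨x, hx, rfl⟩
    have hlab := ω.inter_planeBasis_label hx.1
    refine ⟨?_, ?_, ?_⟩
    · rw [count, hlab, Set.encard_singleton]
    · rw [count, ← Set.inter_assoc, hlab, Set.singleton_inter_of_mem hx.2, Set.encard_singleton]
    · rintro j hj ⟨h1, h2⟩
      obtain ⟨y, hy⟩ := Set.encard_eq_one.1 h1
      obtain ⟨z, hz⟩ := Set.encard_eq_one.1 h2
      rw [← Set.inter_assoc, hlab] at hz
      have hxz : x ∈ planeBasis j := by
        have : z ∈ ({x} : Set Plane) ∩ planeBasis j := hz ▸ rfl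
        rw [← Set.mem_singleton_iff.1 this.1]; exact this.2
      have hxy : x = y := by
        have : x ∈ ω.nodes ∩ planeBasis j := ⟨hx.1, hxz⟩
        rwa [hy] at this
      subst hxy
      exact Nat.notMem_of_lt_sInf hj hy
  · rintro ⟨h1, h2, h3⟩
    obtain ⟨x, hx⟩ := Set.encard_eq_one.1 h1
    obtain ⟨z, hz⟩ := Set.encard_eq_one.1 h2
    rw [← Set.inter_assoc, hx] at hz
    have hxA : x ∈ A := by
      have : z ∈ ({x} : Set Plane) ∩ A := hz ▸ rfl
      rw [← Set.mem_singleton_iff.1 this.1]; exact this.2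
    have hxn : x ∈ ω.nodes ∩ planeBasis i := hx ▸ rfl
    refine ⟨x, ⟨hxn.1, hxA⟩, le_antisymm (Nat.sInf_le hx) ?_⟩
    by_contra! hlt
    have hlab := ω.inter_planeBasis_label hxn.1
    refine h3 _ hlt ⟨by rw [count, hlab, Set.encard_singleton], ?_⟩
    have hxl : x ∈ ω.nodes ∩ planeBasis (ω.label x) := hlab ▸ rfl
    rw [count, ← Set.inter_assoc, hx, Set.singleton_inter_of_mem hxl.2, Set.encard_singleton]

lemma measurable_labels {A : Set Plane} (hA : MeasurableSet A) :
    Measurable fun ω : Configuration => ω.labels A := by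
  refine measurable_set_iff.2 fun i => ?_
  simp_rw [mem_labels_iff]
  have h1 : ∀ B, MeasurableSet B → Measurable fun ω : Configuration => ω.count B = 1 :=
    fun B hB => (measurable_count hB).eq_const 1
  have hb := measurableSet_planeBasis
  exact (h1 _ (hb i)).and ((h1 _ ((hb i).inter hA)).and (Measurable.forall fun j =>
    Measurable.imp measurable_const ((h1 _ (hb j)).and (h1 _ ((hb i).inter (hb j)))).not))

/-- The nodes whose labels belong to `ξ`. -/
def thin (ω : Configuration) (ξ : ℕ → Bool) : Configuration where
  nodes := {x ∈ ω.nodes | ξ (ω.label x) = true}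
  locallyFinite r := (ω.locallyFinite r).subset (Set.inter_subset_inter_left _ (Set.sep_subset _ _))

lemma thin_nodes_subset (ω : Configuration) (ξ : ℕ → Bool) : (ω.thin ξ).nodes ⊆ ω.nodes :=
  Set.sep_subset _ _

lemma count_thin (ω : Configuration) (ξ : ℕ → Bool) (A : Set Plane) :
    (ω.thin ξ).count A = (ω.labels A ∩ {i | ξ i = true}).encard := by
  have : ω.labels A ∩ {i | ξ i = true} = ω.label '' ((ω.thin ξ).nodes ∩ A) := by
    ext i
    constructor
    · rintro ⟨⟨x, hx, rfl⟩, hi⟩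
      exact ⟨x, ⟨⟨hx.1, hi⟩, hx.2⟩, rfl⟩
    · rintro ⟨x, hx, rfl⟩
      exact ⟨⟨x, ⟨hx.1.1, hx.2⟩, rfl⟩, hx.1.2⟩
  rw [this, (ω.injOn_label.mono _).encard_image]
  · rfl
  · exact fun x hx => hx.1.1

lemma measurable_thin : Measurable fun z : Configuration × (ℕ → Bool) => z.1.thin z.2 := by
  refine measurable_of_count fun A hA => ?_
  simp_rw [count_thin]
  refine measurable_encard.comp (measurable_set_iff.2 fun i => ?_)
  have h2 : Measurable fun z : Configuration × (ℕ → Bool) => z.2 i = true :=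
    (show Measurable fun z : Configuration × (ℕ → Bool) => z.2 i by fun_prop).eq_const true
  exact (measurable_set_iff.1 ((measurable_labels hA).comp measurable_fst) i).and h2

end Configuration

/-! ### Independent thinning -/

/-- The law of independent marks, each equal to `true` with probability `p`. -/
noncomputable def markMeasure (p : unitInterval) : Measure (ℕ → Bool) :=
  Measure.infinitePi fun _ => bernoulliMeasure true false p

instance (p : unitInterval) : IsProbabilityMeasure (markMeasure p) := by
  unfold markMeasure; infer_instance

/-- The binomial probability that exactly `k` of `m` independent marks are `true`. -/
noncomputable def binomialMass (p : unitInterval) (m k : ℕ) : ENNReal :=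
  ENNReal.ofReal (m.choose k * (p : ℝ) ^ k * (1 - p : ℝ) ^ (m - k))

/-- Poisson splitting: with `m = k + l`, the joint mass of `k` kept and `l` discarded points factors
into Poisson masses with means `p * r` and `(1 - p) * r`, and the second factor sums to one. -/
lemma lintegral_binomialMass (p : unitInterval) {r s : ℝ≥0} (hs : (s : ℝ) = p * r) (k : ℕ) :
    ∫⁻ m, binomialMass p m k ∂poissonMeasure r = poissonMeasure s {k} := by
  have hp0 : 0 ≤ 1 - (p : ℝ) := sub_nonneg.2 p.2.2
  have hp1 : 0 ≤ (p : ℝ) := p.2.1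
  set t : ℝ≥0 := ⟨(1 - p) * r, by positivity⟩
  have ht' : (t : ℝ) = (1 - p) * r := rfl
  rw [lintegral_countable']
  have hsupp : Function.support (fun m => binomialMass p m k * poissonMeasure r {m}) ⊆
      Set.range (k + ·) := by
    intro m hm
    by_contra hlt
    have : m < k := by
      by_contra! h
      exact hlt ⟨m - k, Nat.add_sub_cancel' h⟩
    exact hm (by simp [binomialMass, Nat.choose_eq_zero_of_lt this])
  rw [← (add_right_injective k).tsum_eq hsupp]
  have hterm : ∀ l, binomialMass p (k + l) k * poissonMeasure r {k + l} =
      poissonMeasure s {k} * poissonMeasure t {l} := by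
    intro l
    simp only [binomialMass, poissonMeasure_singleton]
    rw [← ENNReal.ofReal_mul (by positivity), ← ENNReal.ofReal_mul (by positivity)]
    congr 1
    have hexp : Real.exp (-r) = Real.exp (-s) * Real.exp (-t) := by
      rw [← Real.exp_add, hs, ht']; congr 1; ring
    have hch : ((k + l).choose k : ℝ) = (k + l).factorial / (k.factorial * l.factorial) := by
      rw [Nat.cast_choose ℝ (Nat.le_add_right k l), Nat.add_sub_cancel_left]
    rw [hexp, hch, Nat.add_sub_cancel_left, hs, ht', mul_pow, mul_pow, pow_add]
    have := Nat.factorial_ne_zero (k + l)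
    field_simp
  simp_rw [hterm, ENNReal.tsum_mul_left]
  have h1 : ∑' l, poissonMeasure t {l} = 1 := by
    have := lintegral_countable' (μ := poissonMeasure t) fun _ => 1
    simpa using this.symm
  rw [h1, mul_one]

lemma prod_bernoulliMeasure_of_subset (p : unitInterval) {I T : Finset ℕ} (hT : T ⊆ I) :
    ∏ i ∈ I, bernoulliMeasure true false p {decide (i ∈ T)} =
      ENNReal.ofReal ((p : ℝ) ^ T.card * (1 - p : ℝ) ^ (I.card - T.card)) := by
  have hp0 : 0 ≤ 1 - (p : ℝ) := sub_nonneg.2 p.2.2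
  have hp1 : 0 ≤ (p : ℝ) := p.2.1
  have h : ∀ i, bernoulliMeasure true false p {decide (i ∈ T)} =
      ENNReal.ofReal (if i ∈ T then (p : ℝ) else 1 - p) := by
    intro i
    rw [← ofReal_measureReal]
    by_cases hi : i ∈ T <;> simp [hi]
  simp_rw [h]
  rw [← ENNReal.ofReal_prod_of_nonneg fun i _ => by split_ifs <;> assumption]
  rw [Finset.prod_ite, Finset.prod_const, Finset.prod_const, Finset.filter_mem_eq_inter,
    Finset.inter_eq_right.2 hT, Finset.filter_notMem_eq_sdiff, Finset.card_sdiff_of_subset hT]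

/-- The numbers of `true` marks in disjoint finite sets are independent and binomial. -/
lemma markMeasure_encard_eq (p : unitInterval) {n : ℕ} (I : Fin n → Finset ℕ)
    (hI : Pairwise fun i j => Disjoint (I i) (I j)) (k : Fin n → ℕ) :
    markMeasure p {ξ | ∀ i, ((I i : Set ℕ) ∩ {j | ξ j = true}).encard = k i} =
      ∏ i, binomialMass p (I i).card (k i) := by
  classical
  -- The event is partitioned according to the sets `T i ⊆ I i` of `true` marks, of size `k i`; `E
  -- T` is the cylinder prescribing every mark in `U`.
  set U : Finset ℕ := Finset.univ.biUnion I
  set C : Finset (Fin n → Finset ℕ) :=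
    Fintype.piFinset fun i => (I i).powersetCard (k i)
  set E : (Fin n → Finset ℕ) → Set (ℕ → Bool) := fun T =>
    Set.pi U fun j => {decide (j ∈ Finset.univ.biUnion T)}
  have hmem : ∀ T ∈ C, ∀ i, ∀ j ∈ I i, j ∈ Finset.univ.biUnion T ↔ j ∈ T i := by
    intro T hT i j hj
    simp only [C, Fintype.mem_piFinset, Finset.mem_powersetCard] at hT
    simp only [Finset.mem_biUnion, Finset.mem_univ, true_and]
    refine ⟨fun ⟨i', hi'⟩ => ?_, fun h => ⟨i, h⟩⟩
    by_cases hii : i' = i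
    · exact hii ▸ hi'
    · exact (Finset.disjoint_left.1 (hI hii) ((hT i').1 hi') hj).elim
  have hE : {ξ : ℕ → Bool | ∀ i, ((I i : Set ℕ) ∩ {j | ξ j = true}).encard = k i} =
      ⋃ T ∈ C, E T := by
    ext ξ
    simp only [Set.mem_ofPred_eq, Set.mem_iUnion, exists_prop]
    constructor
    · intro h
      have hT : (fun i => (I i).filter fun j => ξ j = true) ∈ C := by
        simp only [C, Fintype.mem_piFinset, Finset.mem_powersetCard]
        refine fun i => ⟨Finset.filter_subset _ _, ?_⟩
        have := h i
        rw [show (I i : Set ℕ) ∩ {j | ξ j = true} = ((I i).filter fun j => ξ j = true) by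
          ext; simp, Set.encard_coe_eq_coe_finsetCard] at this
        exact_mod_cast this
      refine ⟨_, hT, fun j hj => ?_⟩
      obtain ⟨i, -, hji⟩ := Finset.mem_biUnion.1 hj
      have := hmem _ hT i j hji
      simp only [Finset.mem_filter, hji, true_and] at this
      simp only [Set.mem_singleton_iff, this, Bool.decide_eq_true]
    · rintro ⟨T, hT, hξ⟩ i
      have hT' := hT
      simp only [C, Fintype.mem_piFinset, Finset.mem_powersetCard] at hT'
      have : (I i : Set ℕ) ∩ {j | ξ j = true} = T i := by
        ext j
        simp only [Set.mem_inter_iff, Finset.mem_coe, Set.mem_ofPred_eq]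
        constructor
        · rintro ⟨hj, hjt⟩
          have := hξ j (Finset.mem_biUnion.2 ⟨i, Finset.mem_univ _, hj⟩)
          rw [Set.mem_singleton_iff, hjt] at this
          exact (hmem T hT i j hj).1 (of_decide_eq_true this.symm)
        · intro hj
          have hjI := (hT' i).1 hj
          have := hξ j (Finset.mem_biUnion.2 ⟨i, Finset.mem_univ _, hjI⟩)
          rw [Set.mem_singleton_iff] at this
          exact ⟨hjI, this.trans (decide_eq_true ((hmem T hT i j hjI).2 hj))⟩
      rw [this, Set.encard_coe_eq_coe_finsetCard, (hT' i).2]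
  have hdisj : (C : Set (Fin n → Finset ℕ)).PairwiseDisjoint E := by
    intro T hT T' hT' hne
    refine Set.disjoint_left.2 fun ξ hξ hξ' => hne (funext fun i => ?_)
    have hTi := (Finset.mem_powersetCard.1 (Fintype.mem_piFinset.1 hT i)).1
    have hTi' := (Finset.mem_powersetCard.1 (Fintype.mem_piFinset.1 hT' i)).1
    have key : ∀ j ∈ I i, j ∈ T i ↔ j ∈ T' i := by
      intro j hj
      have hjU : j ∈ U := Finset.mem_biUnion.2 ⟨i, Finset.mem_univ _, hj⟩
      have h1 := hξ j hjU
      have h2 := hξ' j hjU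
      rw [Set.mem_singleton_iff] at h1 h2
      rw [← hmem T hT i j hj, ← hmem T' hT' i j hj]
      exact decide_eq_decide.1 (h1.symm.trans h2)
    ext j
    exact ⟨fun h => (key j (hTi h)).1 h, fun h => (key j (hTi' h)).2 h⟩
  have hmeas : ∀ T, MeasurableSet (E T) := fun T =>
    MeasurableSet.pi (Finset.countable_toSet U) fun j _ => measurableSet_singleton _
  have hval : ∀ T ∈ C, markMeasure p (E T) =
      ∏ i, ∏ j ∈ I i, bernoulliMeasure true false p {decide (j ∈ T i)} := by
    intro T hT
    rw [markMeasure, Measure.infinitePi_pi _ fun j _ => measurableSet_singleton _,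
      Finset.prod_biUnion fun i _ j _ hij => hI hij]
    refine Finset.prod_congr rfl fun i _ => Finset.prod_congr rfl fun j hj => ?_
    simp only [hmem T hT i j hj]
  -- A sum over families `T` of products over `i` is a product of sums; in the `i`-th sum all terms
  -- are equal.
  rw [hE, measure_biUnion_finset hdisj fun T _ => hmeas T, Finset.sum_congr rfl hval,
    ← Finset.prod_univ_sum (fun i => (I i).powersetCard (k i))
      fun i T => ∏ j ∈ I i, bernoulliMeasure true false p {decide (j ∈ T)}]
  refine Finset.prod_congr rfl fun i _ => ?_
  have : ∀ T ∈ (I i).powersetCard (k i),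
      ∏ j ∈ I i, bernoulliMeasure true false p {decide (j ∈ T)} =
        ENNReal.ofReal ((p : ℝ) ^ k i * (1 - p : ℝ) ^ ((I i).card - k i)) := by
    intro T hT
    obtain ⟨hTI, hTk⟩ := Finset.mem_powersetCard.1 hT
    rw [prod_bernoulliMeasure_of_subset p hTI, hTk]
  rw [Finset.sum_congr rfl this, Finset.sum_const, Finset.card_powersetCard, nsmul_eq_mul,
    binomialMass, mul_assoc, ENNReal.ofReal_mul (Nat.cast_nonneg _), ENNReal.ofReal_natCast]

/-- Keeping every point of a Poisson point process independently with probability `p` gives a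
Poisson point process. -/
lemma IsPoissonPointProcess.thin {Ω : Type} [MeasurableSpace Ω] {P : Measure Ω}
    [IsProbabilityMeasure P] {X : Ω → Configuration} {lam mu : ℝ≥0}
    (hX : IsPoissonPointProcess P X lam) (p : unitInterval) (hmu : (mu : ℝ) = p * lam) :
    IsPoissonPointProcess (P.prod (markMeasure p))
      (fun z : Ω × (ℕ → Bool) => (X z.1).thin z.2) mu := by
  have hmeas : Measurable fun z : Ω × (ℕ → Bool) => (X z.1).thin z.2 :=
    Configuration.measurable_thin.comp
      ((hX.measurable.comp measurable_fst).prodMk measurable_snd)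
  refine hX.of_fiberwise hmeas (fun _ => binomialMass p) (fun n A hA hb hd k ω => ?_)
    fun A hA hb k => lintegral_binomialMass p (by push_cast; rw [hmu]; ring) k
  have hfin : ∀ i, ((X ω).labels (A i)).Finite := fun i => (X ω).finite_labels (hb i)
  have := markMeasure_encard_eq p (fun i => (hfin i).toFinset) (fun i j hij => by
    exact Set.Finite.disjoint_toFinset.2 ((X ω).disjoint_labels (hd hij))) k
  simp only [Set.Finite.coe_toFinset] at this
  simp only [Configuration.count_thin, this]
  refine Finset.prod_congr rfl fun i _ => ?_
  rw [← (X ω).encard_labels, (hfin i).encard_eq_coe_toFinset_card, ENat.toNat_natCast]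

/-! ### Union and dilation of configurations -/

namespace Configuration

/-- The union of two configurations. -/
def union (ω ω' : Configuration) : Configuration where
  nodes := ω.nodes ∪ ω'.nodes
  locallyFinite r := by
    rw [Set.union_inter_distrib_right]
    exact (ω.locallyFinite r).union (ω'.locallyFinite r)

lemma count_union {ω ω' : Configuration} (h : Disjoint ω.nodes ω'.nodes) (A : Set Plane) :
    (ω.union ω').count A = ω.count A + ω'.count A := by
  rw [count, union, Set.union_inter_distrib_right]
  exact Set.encard_union_eq (h.mono Set.inter_subset_left Set.inter_subset_left)

/-- This countable description by counts makes disjointness measurable. If the two isolated nodes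
differed, a basis set containing the first but not the second would give different counts. -/
lemma not_disjoint_iff {ω ω' : Configuration} : ¬ Disjoint ω.nodes ω'.nodes ↔
    ∃ i, ω.count (planeBasis i) = 1 ∧ ω'.count (planeBasis i) = 1 ∧
      ∀ j, ω.count (planeBasis i ∩ planeBasis j) = ω'.count (planeBasis i ∩ planeBasis j) := by
  constructor
  · intro h
    obtain ⟨x, hx, hx'⟩ := Set.not_disjoint_iff.1 h
    obtain ⟨i, hi⟩ := (ω.union ω').exists_planeBasis_inter_eq (x := x) (Or.inl hx)
    have hxi : x ∈ (ω.union ω').nodes ∩ planeBasis i := hi ▸ rfl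
    have h1 : ω.nodes ∩ planeBasis i = {x} := by
      refine Set.Subset.antisymm ?_ (by rintro _ rfl; exact ⟨hx, hxi.2⟩)
      rw [← hi]
      exact Set.inter_subset_inter_left _ Set.subset_union_left
    have h2 : ω'.nodes ∩ planeBasis i = {x} := by
      refine Set.Subset.antisymm ?_ (by rintro _ rfl; exact ⟨hx', hxi.2⟩)
      rw [← hi]
      exact Set.inter_subset_inter_left _ Set.subset_union_right
    refine ⟨i, ?_, ?_, fun j => ?_⟩
    · rw [count, h1, Set.encard_singleton]
    · rw [count, h2, Set.encard_singleton]
    · rw [count, count, ← Set.inter_assoc, ← Set.inter_assoc, h1, h2]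
  · rintro ⟨i, h1, h2, h3⟩
    obtain ⟨x, hx⟩ := Set.encard_eq_one.1 h1
    obtain ⟨y, hy⟩ := Set.encard_eq_one.1 h2
    have hxm : x ∈ ω.nodes ∩ planeBasis i := hx ▸ rfl
    have hym : y ∈ ω'.nodes ∩ planeBasis i := hy ▸ rfl
    refine Set.not_disjoint_iff.2 ⟨x, hxm.1, ?_⟩
    suffices x = y from this ▸ hym.1
    by_contra hne
    obtain ⟨_, ⟨j, rfl⟩, hxj, hj⟩ := isTopologicalBasis_planeBasis.exists_subset_of_mem_open
      (show x ∈ ({y} : Set Plane)ᶜ from hne) isOpen_compl_singleton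
    have h := h3 j
    rw [count, count, ← Set.inter_assoc, ← Set.inter_assoc, hx, hy,
      Set.singleton_inter_of_mem hxj, Set.encard_singleton,
      Set.singleton_inter_eq_empty.2 fun hyj => hj hyj rfl] at h
    simp at h

lemma measurableSet_disjoint :
    MeasurableSet {z : Configuration × Configuration | Disjoint z.1.nodes z.2.nodes} := by
  rw [← MeasurableSet.compl_iff, Set.compl_ofPred]
  simp_rw [not_disjoint_iff]
  have hb := measurableSet_planeBasis
  have h1 : ∀ B, MeasurableSet B → Measurable fun z : Configuration × Configuration =>
    z.1.count B := fun B hB => (measurable_count hB).comp measurable_fst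
  have h2 : ∀ B, MeasurableSet B → Measurable fun z : Configuration × Configuration =>
    z.2.count B := fun B hB => (measurable_count hB).comp measurable_snd
  exact measurableSet_setOfPred.2 (Measurable.exists fun i => ((h1 _ (hb i)).eq_const 1).and
    (((h2 _ (hb i)).eq_const 1).and (Measurable.forall fun j =>
      measurableSet_setOfPred.1 (measurableSet_eq_fun (h1 _ ((hb i).inter (hb j)))
        (h2 _ ((hb i).inter (hb j)))))))

open Classical in
/-- The union of two configurations if they are disjoint, and otherwise the first of them. -/
noncomputable def superpose (ω ω' : Configuration) : Configuration :=
  if Disjoint ω.nodes ω'.nodes then ω.union ω' else ω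

lemma nodes_subset_superpose (ω ω' : Configuration) : ω.nodes ⊆ (ω.superpose ω').nodes := by
  unfold superpose
  split_ifs
  · exact Set.subset_union_left
  · exact subset_rfl

lemma count_superpose {ω ω' : Configuration} (h : Disjoint ω.nodes ω'.nodes) (A : Set Plane) :
    (ω.superpose ω').count A = ω.count A + ω'.count A := by
  rw [superpose, if_pos h, count_union h]

lemma measurable_superpose :
    Measurable fun z : Configuration × Configuration => z.1.superpose z.2 := by
  classical
  refine measurable_of_count fun A hA => ?_
  have : (fun z : Configuration × Configuration => (z.1.superpose z.2).count A) = fun z =>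
      if Disjoint z.1.nodes z.2.nodes then z.1.count A + z.2.count A else z.1.count A := by
    funext z
    by_cases h : Disjoint z.1.nodes z.2.nodes
    · rw [count_superpose h, if_pos h]
    · rw [superpose, if_neg h, if_neg h]
  rw [this]
  have h1 : Measurable fun z : Configuration × Configuration => z.1.count A :=
    (measurable_count hA).comp measurable_fst
  have h2 : Measurable fun z : Configuration × Configuration => z.2.count A :=
    (measurable_count hA).comp measurable_snd
  exact Measurable.ite measurableSet_disjoint
    ((measurable_of_countable fun q : ℕ∞ × ℕ∞ => q.1 + q.2).comp (h1.prodMk h2)) h1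

/-- The configuration dilated by the factor `c`. -/
def dilate (c : ℝ) (hc : c ≠ 0) (ω : Configuration) : Configuration where
  nodes := (c • ·) ⁻¹' ω.nodes
  locallyFinite r := by
    have : (fun x : Plane => c • x) ⁻¹' ω.nodes ∩ Metric.closedBall 0 r ⊆
        (c • ·) ⁻¹' (ω.nodes ∩ Metric.closedBall 0 (|c| * r)) := by
      rintro x ⟨hx, hr⟩
      refine ⟨hx, ?_⟩
      rw [mem_closedBall_zero_iff] at hr ⊢
      rw [norm_smul, Real.norm_eq_abs]
      gcongr
    exact ((ω.locallyFinite _).preimage (smul_right_injective Plane hc).injOn).subset this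

lemma count_dilate (c : ℝ) (hc : c ≠ 0) (ω : Configuration) (A : Set Plane) :
    (dilate c hc ω).count A = ω.count ((c⁻¹ • ·) ⁻¹' A) := by
  have : ω.nodes ∩ (c⁻¹ • ·) ⁻¹' A = (c • ·) '' ((dilate c hc ω).nodes ∩ A) := by
    ext x
    constructor
    · rintro ⟨hx, hA⟩
      exact ⟨c⁻¹ • x, ⟨by simpa [dilate, hc] using hx, hA⟩, by simp [hc]⟩
    · rintro ⟨y, ⟨hy, hA⟩, rfl⟩
      exact ⟨hy, by simpa [hc] using hA⟩
  rw [count, count, this, (smul_right_injective Plane hc).encard_image]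

end Configuration

/-! ### Poisson processes under dilation and superposition -/

namespace IsPoissonPointProcess

variable {Ω : Type} [MeasurableSpace Ω] {P : Measure Ω} {X : Ω → Configuration} {lam : ℝ≥0}

/-- The new nodes are `c⁻¹ • x`, so the count in `A` is that of `X` in `c • A`, whose area is `c ^
2` times that of `A`. -/
lemma dilate (hX : IsPoissonPointProcess P X lam) {c : ℝ} (hc : c ≠ 0) {mu : ℝ≥0}
    (hmu : (mu : ℝ) = c ^ 2 * lam) :
    IsPoissonPointProcess P (fun ω => Configuration.dilate c hc (X ω)) mu := by
  have hm : ∀ A : Set Plane, MeasurableSet A → MeasurableSet ((c⁻¹ • · : Plane → Plane) ⁻¹' A) :=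
    fun A hA => measurable_const_smul c⁻¹ hA
  have hb : ∀ A : Set Plane, Bornology.IsBounded A →
      Bornology.IsBounded ((c⁻¹ • · : Plane → Plane) ⁻¹' A) := by
    intro A hA
    rw [Set.preimage_smul_inv₀ hc]
    exact hA.smul₀ c
  refine ⟨?_, fun A hA hbA k => ?_, fun n A hA hbA hd => ?_⟩
  · refine Configuration.measurable_of_count fun A hA => ?_
    simp_rw [Configuration.count_dilate]
    exact (Configuration.measurable_count (hm A hA)).comp hX.measurable
  · simp_rw [Configuration.count_dilate]
    rw [hX.poisson _ (hm A hA) (hb A hbA)]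
    congr 2
    rw [Measure.addHaar_preimage_smul _ (inv_ne_zero hc)]
    have hc2 : ((ENNReal.ofReal (c ^ 2)).toNNReal : ℝ) = c ^ 2 :=
      ENNReal.toReal_ofReal (sq_nonneg c)
    ext
    simp [hmu, hc2]
    ring
  · simp_rw [Configuration.count_dilate]
    exact hX.indep n _ (fun i => hm _ (hA i)) (fun i => hb _ (hbA i))
      fun i j hij => (hd hij).preimage _

/-- A singleton has area zero, so its count is almost surely zero. -/
lemma ae_disjoint [IsProbabilityMeasure P] (hX : IsPoissonPointProcess P X lam) {S : Set Plane}
    (hS : S.Countable) : ∀ᵐ ω ∂P, Disjoint S (X ω).nodes := by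
  have h : ∀ x : Plane, ∀ᵐ ω ∂P, (X ω).count {x} = (0 : ℕ) := by
    intro x
    have hset : MeasurableSet {ω | (X ω).count {x} = (0 : ℕ)} :=
      (Configuration.measurable_count (measurableSet_singleton x)).comp hX.measurable
        (measurableSet_singleton _)
    refine (mem_ae_iff_prob_eq_one hset).2 ?_
    rw [hX.poisson _ (measurableSet_singleton x) Bornology.isBounded_singleton]
    simp [poissonMeasure_singleton]
  filter_upwards [(ae_ball_iff hS).2 fun x _ => h x] with ω hω
  refine Set.disjoint_left.2 fun x hx hxX => ?_
  have := hω x hx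
  rw [Configuration.count, Set.inter_singleton_of_mem hxX, Set.encard_singleton] at this
  simp at this

/-- The superposition of two independent Poisson point processes. -/
lemma superpose [IsProbabilityMeasure P] {Ω' : Type} [MeasurableSpace Ω'] {Q : Measure Ω'}
    [IsProbabilityMeasure Q] {X' : Ω' → Configuration} {mu : ℝ≥0}
    (hX : IsPoissonPointProcess P X lam) (hX' : IsPoissonPointProcess Q X' mu) :
    IsPoissonPointProcess (P.prod Q) (fun z : Ω × Ω' => (X z.1).superpose (X' z.2))
      (lam + mu) := by
  have hmeas : Measurable fun z : Ω × Ω' => (X z.1).superpose (X' z.2) :=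
    Configuration.measurable_superpose.comp
      ((hX.measurable.comp measurable_fst).prodMk (hX'.measurable.comp measurable_snd))
  refine hX.of_fiberwise hmeas
    (fun A m k => poissonMeasure (mu * (volume A).toNNReal) {l | m + l = k})
    (fun n A hA hb hd k ω => ?_) fun A hA hb k => ?_
  -- For fixed `ω` the nodes of `X ω` are countable, hence almost surely avoided by `X'`. The
  -- fallback case of `superpose` is negligible and counts add.
  · have hae : {ω' | ∀ i, ((X ω).superpose (X' ω')).count (A i) = k i} =ᵐ[Q]
        ⋂ i ∈ Finset.univ, (fun ω' => (X' ω').count (A i)) ⁻¹'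
          {l | (X ω).count (A i) + l = k i} := by
      filter_upwards [hX'.ae_disjoint (X ω).countable_nodes] with ω' hω'
      refine propext ?_
      change (∀ i, ((X ω).superpose (X' ω')).count (A i) = k i) ↔ ω' ∈ (⋂ i ∈ Finset.univ, _)
      simp [Configuration.count_superpose hω']
    rw [measure_congr hae, (hX'.indep n A hA hb hd).measure_inter_preimage_eq_mul _
      fun i _ => MeasurableSet.of_discrete]
    refine Finset.prod_congr rfl fun i _ => ?_
    have hm' : Measurable fun ω => ((X' ω).count (A i)).toNat :=
      (measurable_of_countable _).comp ((Configuration.measurable_count (hA i)).comp hX'.measurable)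
    rw [← hX'.map_toNat_count (hA i) (hb i), Measure.map_apply hm' .of_discrete]
    congr 1
    ext ω'
    have h1 := (X ω).count_ne_top (hb i)
    have h2 := (X' ω').count_ne_top (hb i)
    simp only [Set.mem_preimage, Set.mem_ofPred_eq]
    lift (X ω).count (A i) to ℕ using h1 with a
    lift (X' ω').count (A i) to ℕ using h2 with b
    simp only [ENat.toNat_natCast]
    norm_cast
  · rw [add_mul, ← poissonMeasure_conv_poissonMeasure, Measure.conv,
      Measure.map_apply (by fun_prop) (measurableSet_singleton _),
      Measure.prod_apply (MeasurableSet.of_discrete)]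
    rfl

end IsPoissonPointProcess

/-! ### Enlarging the probability space -/

section ProductSpace

variable {Ω Ω' : Type} [MeasurableSpace Ω] [MeasurableSpace Ω'] {P : Measure Ω} {Q : Measure Ω'}
  [IsProbabilityMeasure Q]

lemma prod_preimage_fst [SFinite P] (S : Set Ω) : (P.prod Q) (Prod.fst ⁻¹' S) = P S := by
  rw [← Set.prod_univ, Measure.prod_prod, measure_univ, mul_one]

/-- The product formula for rectangles holds for arbitrary sets, so `p` need not be measurable. Thus
measurability of the percolation event is never needed. -/
lemma ae_of_ae_prod_fst [SFinite P] {p : Ω → Prop} (h : ∀ᵐ z ∂P.prod Q, p z.1) : ∀ᵐ ω ∂P, p ω := by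
  rw [ae_iff] at h ⊢
  rwa [← prod_preimage_fst (Q := Q)]

/-- Auxiliary randomness may be attached to one network without spoiling its independence from the
other. Integrating out the second coordinate leaves a function of `X` times an indicator in `Z`. -/
lemma IndepFun.prodMk_snd [SFinite P] {α β : Type*} [MeasurableSpace α] [MeasurableSpace β] {X : Ω → α}
    {Z : Ω → β} (hX : Measurable X) (hZ : Measurable Z) (h : IndepFun X Z P) :
    IndepFun (fun z : Ω × Ω' => (X z.1, z.2)) (fun z => Z z.1) (P.prod Q) := by
  rw [indepFun_iff_measure_inter_preimage_eq_mul]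
  intro S T hS hT
  have hXS : MeasurableSet ((fun z : Ω × Ω' => (X z.1, z.2)) ⁻¹' S) :=
    ((hX.comp measurable_fst).prodMk measurable_snd) hS
  have hZT : MeasurableSet ((fun z : Ω × Ω' => Z z.1) ⁻¹' T) := (hZ.comp measurable_fst) hT
  have hf : Measurable fun x : α => Q (Prod.mk x ⁻¹' S) := measurable_measure_prodMk_left hS
  have hg : Measurable (T.indicator (1 : β → ENNReal)) := measurable_one.indicator hT
  have hZP : (P.prod Q) ((fun z : Ω × Ω' => Z z.1) ⁻¹' T) = P (Z ⁻¹' T) :=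
    prod_preimage_fst (Z ⁻¹' T)
  have hint : ∀ ω, Q (Prod.mk ω ⁻¹' ((fun z : Ω × Ω' => (X z.1, z.2)) ⁻¹' S ∩
      (fun z : Ω × Ω' => Z z.1) ⁻¹' T)) =
      Q (Prod.mk (X ω) ⁻¹' S) * T.indicator (1 : β → ENNReal) (Z ω) := by
    intro ω
    by_cases hω : Z ω ∈ T
    · rw [Set.indicator_of_mem hω, Pi.one_apply, mul_one]
      congr 1
      ext ξ
      simp [hω]
    · rw [Set.indicator_of_notMem hω, mul_zero]
      convert measure_empty (μ := Q)
      ext ξ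
      simp [hω]
  rw [Measure.prod_apply (hXS.inter hZT), Measure.prod_apply hXS, hZP]
  simp_rw [hint]
  refine (lintegral_mul_eq_lintegral_mul_lintegral_of_indepFun (hf.comp hX) (hg.comp hZ)
    (h.comp hf hg)).trans ?_
  congr 1
  simp only [Function.comp_def]
  rw [show (fun ω => T.indicator (1 : β → ENNReal) (Z ω)) = (Z ⁻¹' T).indicator 1 from rfl,
    lintegral_indicator_one (hZ hT)]

lemma IsPoissonPointProcess.comp_fst [SFinite P] {X : Ω → Configuration} {lam : ℝ≥0}
    (hX : IsPoissonPointProcess P X lam) :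
    IsPoissonPointProcess (P.prod Q) (fun z : Ω × Ω' => X z.1) lam := by
  refine ⟨hX.measurable.comp measurable_fst, fun A hA hb k => ?_, fun n A hA hb hd => ?_⟩
  · rw [← hX.poisson A hA hb k]
    exact prod_preimage_fst {ω | (X ω).count A = k}
  · have := hX.indep n A hA hb hd
    rw [iIndepFun_iff_measure_inter_preimage_eq_mul] at this ⊢
    intro S sets hsets
    rw [show (⋂ i ∈ S, (fun z : Ω × Ω' => (X z.1).count (A i)) ⁻¹' sets i) =
      Prod.fst ⁻¹' (⋂ i ∈ S, (fun ω => (X ω).count (A i)) ⁻¹' sets i) by ext; simp,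
      prod_preimage_fst, this S hsets]
    exact Finset.prod_congr rfl fun i _ => (prod_preimage_fst _).symm

end ProductSpace

/-! ### Monotonicity in the parameters -/

lemma exists_unitInterval_mul_eq {mu lam : ℝ≥0} (h : mu ≤ lam) :
    ∃ p : unitInterval, (mu : ℝ) = p * lam := by
  rcases eq_or_ne lam 0 with rfl | h0
  · exact ⟨0, by simp [nonpos_iff_eq_zero.1 h]⟩
  · have h0' : (lam : ℝ) ≠ 0 := by exact_mod_cast h0
    exact ⟨⟨mu / lam, by positivity, div_le_one_of_le₀ (by exact_mod_cast h) lam.2⟩,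
      (div_mul_cancel₀ _ h0').symm⟩

lemma HasUnboundedComponent.mono {ω ω' : Configuration} {opp opp' : Plane → Plane → Prop}
    (hω : ω.nodes ⊆ ω'.nodes) (hopp : ∀ x y, opp x y → opp' x y)
    (h : HasUnboundedComponent ω opp) : HasUnboundedComponent ω' opp' := by
  obtain ⟨x, hx, hinf⟩ := h
  exact ⟨x, hω hx, hinf.mono fun y hy =>
    ⟨hω hy.1, Relation.ReflTransGen.mono
      (fun a b hab => ⟨hopp _ _ hab.1, hopp _ _ hab.2⟩) _ _ hy.2⟩⟩

lemma PrimaryOpportunity.mono {Dt Dt' : ℝ≥0} {ωp ωp' : Configuration} (hDt : Dt ≤ Dt')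
    (hp : ωp.nodes ⊆ ωp'.nodes) (x y : Plane) (h : PrimaryOpportunity Dt ωp x y) :
    PrimaryOpportunity Dt' ωp' x y :=
  ⟨hp h.1, hp h.2.1, h.2.2.trans (by exact_mod_cast hDt)⟩

lemma SecondaryOpportunity.mono {dt dt' Df Df' : ℝ≥0} {ωp ωp' ωs ωs' : Configuration}
    (hdt : dt ≤ dt') (hDf : Df' ≤ Df) (hp : ωp'.nodes ⊆ ωp.nodes) (hs : ωs.nodes ⊆ ωs'.nodes)
    (z w : Plane) (h : SecondaryOpportunity dt Df ωp ωs z w) :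
    SecondaryOpportunity dt' Df' ωp' ωs' z w := by
  have hDf' : (Df' : ℝ) ≤ Df := by exact_mod_cast hDf
  exact ⟨hs h.1, hs h.2.1, h.2.2.1.trans (by exact_mod_cast hdt),
    fun ⟨x, hx, hxz⟩ => h.2.2.2.1 ⟨x, hp hx, hxz.trans hDf'⟩,
    fun ⟨x, hx, hxw⟩ => h.2.2.2.2 ⟨x, hp hx, hxw.trans hDf'⟩⟩

namespace SimultaneouslyConnected

lemma mono_radii {Dt Dt' dt dt' Df Df' lamp lams : ℝ≥0} (hDt : Dt ≤ Dt') (hdt : dt ≤ dt')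
    (hDf : Df' ≤ Df) (h : SimultaneouslyConnected Dt dt Df lamp lams) :
    SimultaneouslyConnected Dt' dt' Df' lamp lams := by
  intro Ω _ P _ Xp Xs hp hs hind
  filter_upwards [h Ω P Xp Xs hp hs hind] with ω hω
  exact ⟨hω.1.mono subset_rfl (PrimaryOpportunity.mono hDt subset_rfl),
    hω.2.mono subset_rfl (SecondaryOpportunity.mono hdt hDf subset_rfl subset_rfl)⟩

/-- More secondary nodes help: thin the denser secondary process. -/
lemma mono_secondaryDensity {Dt dt Df lamp lams lams' : ℝ≥0} (hl : lams ≤ lams')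
    (h : SimultaneouslyConnected Dt dt Df lamp lams) :
    SimultaneouslyConnected Dt dt Df lamp lams' := by
  intro Ω _ P _ Xp Xs hp hs hind
  obtain ⟨q, hq⟩ := exists_unitInterval_mul_eq hl
  have hind' := (IndepFun.prodMk_snd (Q := markMeasure q) hs.measurable hp.measurable
    hind.symm).symm.comp measurable_id Configuration.measurable_thin
  refine ae_of_ae_prod_fst (Q := markMeasure q) ?_
  filter_upwards [h _ _ _ _ hp.comp_fst (hs.thin q hq) hind'] with z hz
  exact ⟨hz.1, hz.2.mono (Configuration.thin_nodes_subset _ _)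
    (SecondaryOpportunity.mono le_rfl le_rfl subset_rfl (Configuration.thin_nodes_subset _ _))⟩

/-- Fewer primary nodes help the secondary network, more of them the primary network: thin or
superpose the primary process. -/
lemma of_primaryDensity_between {Dt dt Df lamp₁ lamp lamp₂ lams : ℝ≥0} (h₁ : lamp₁ ≤ lamp)
    (h₂ : lamp ≤ lamp₂) (hc₁ : SimultaneouslyConnected Dt dt Df lamp₁ lams)
    (hc₂ : SimultaneouslyConnected Dt dt Df lamp₂ lams) :
    SimultaneouslyConnected Dt dt Df lamp lams := by
  -- The cases `lamp = 0` and `lamp = lamp₂` are split off because the dilation factor below divides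
  -- by `lamp` and must be nonzero.
  rcases eq_or_ne lamp 0 with rfl | h0
  · rwa [nonpos_iff_eq_zero.1 h₁] at hc₁
  rcases h₂.eq_or_lt with rfl | h₂
  · exact hc₂
  intro Ω _ P _ Xp Xs hp hs hind
  obtain ⟨q, hq⟩ := exists_unitInterval_mul_eq h₁
  refine Filter.Eventually.and ?_ ?_
  · have hind' := (IndepFun.prodMk_snd (Q := markMeasure q) hp.measurable hs.measurable hind).comp
      Configuration.measurable_thin measurable_id
    refine ae_of_ae_prod_fst (Q := markMeasure q) ?_
    filter_upwards [hc₁ _ _ _ _ (hp.thin q hq) hs.comp_fst hind'] with z hz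
    exact hz.1.mono (Configuration.thin_nodes_subset _ _)
      (PrimaryOpportunity.mono le_rfl (Configuration.thin_nodes_subset _ _))
  · have hlt : (0 : ℝ) < lamp₂ - lamp := sub_pos.2 (by exact_mod_cast h₂)
    have hpos : (0 : ℝ) < lamp := by exact_mod_cast pos_iff_ne_zero.2 h0
    -- Dilating an independent copy of `Xp` by this factor gives exactly the missing density `lamp₂
    -- - lamp`.
    set c : ℝ := √((lamp₂ - lamp) / lamp) with hcdef
    have hc : c ≠ 0 := (Real.sqrt_pos.2 (div_pos hlt hpos)).ne'
    have hmu : ((lamp₂ - lamp : ℝ≥0) : ℝ) = c ^ 2 * lamp := by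
      rw [NNReal.coe_sub h₂.le, hcdef, Real.sq_sqrt (div_pos hlt hpos).le,
        div_mul_cancel₀ _ hpos.ne']
    have hd := hp.dilate hc hmu
    have hsup := hp.superpose hd
    rw [add_tsub_cancel_of_le h₂.le] at hsup
    have hind' := (IndepFun.prodMk_snd (Q := P) hp.measurable hs.measurable hind).comp
      (Configuration.measurable_superpose.comp
        (measurable_fst.prodMk (hd.measurable.comp measurable_snd))) measurable_id
    refine ae_of_ae_prod_fst (Q := P) ?_
    filter_upwards [hc₂ _ _ _ _ hsup hs.comp_fst hind'] with z hz
    exact hz.2.mono subset_rfl (SecondaryOpportunity.mono le_rfl le_rfl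
      (Configuration.nodes_subset_superpose _ _) subset_rfl)

end SimultaneouslyConnected

/-! ### Connectedness of the region and its sections -/

/-- The part of the connectivity region whose first three coordinates lie in given intervals is
connected. -/
lemma isPreconnected_connectivityRegion_inter {S₁ S₂ S₃ : Set ℝ≥0} (hS₁ : S₁.OrdConnected)
    (hS₂ : S₂.OrdConnected) (hS₃ : S₃.OrdConnected) :
    IsPreconnected (connectivityRegion ∩ S₁ ×ˢ S₂ ×ˢ S₃ ×ˢ Set.univ) := by
  have key : ∀ q ∈ connectivityRegion ∩ S₁ ×ˢ S₂ ×ˢ S₃ ×ˢ Set.univ,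
      ∀ q' ∈ connectivityRegion ∩ S₁ ×ˢ S₂ ×ˢ S₃ ×ˢ Set.univ, q.2.2.2.1 ≤ q'.2.2.2.1 →
      ∃ t ⊆ connectivityRegion ∩ S₁ ×ˢ S₂ ×ˢ S₃ ×ˢ Set.univ, q ∈ t ∧ q' ∈ t ∧
        IsPreconnected t := by
    rintro ⟨a, b, c, p, s⟩ ⟨hq, ha, hb, hc, -⟩ ⟨a', b', c', p', s'⟩ ⟨hq', ha', hb', hc', -⟩ hpp
    simp only at ha hb hc ha' hb' hc' hpp
    have hA : max a a' ∈ S₁ := max_rec' S₁ ha ha'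
    have hB : max b b' ∈ S₂ := max_rec' S₂ hb hb'
    have hC : min c c' ∈ S₃ := min_rec' S₃ hc hc'
    have hmono : ∀ {x y z u v : ℝ≥0}, (x, y, z, u, v) ∈ connectivityRegion → ∀ r ∈
        Set.Icc x (max a a') ×ˢ Set.Icc y (max b b') ×ˢ Set.Icc (min c c') z ×ˢ {u} ×ˢ
          Set.Icc v (max s s'), r ∈ connectivityRegion := by
      rintro x y z u v h ⟨x', y', z', u', v'⟩ ⟨h1, h2, h3, h4, h5⟩
      obtain rfl : u' = u := h4
      exact (h.mono_radii h1.1 h2.1 h3.2).mono_secondaryDensity h5.1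
    have hbox : ∀ {x y z u v : ℝ≥0}, IsPreconnected
        (Set.Icc x (max a a') ×ˢ Set.Icc y (max b b') ×ˢ Set.Icc (min c c') z ×ˢ {u} ×ˢ
          Set.Icc v (max s s')) := fun {x y z u v} =>
      isPreconnected_Icc.prod (isPreconnected_Icc.prod (isPreconnected_Icc.prod
        (isPreconnected_singleton.prod isPreconnected_Icc)))
    -- `B` and `B'` join each point, at its own primary density, to the common best values of the
    -- other parameters; `L` joins the two resulting corners by varying the primary density.
    set B := Set.Icc a (max a a') ×ˢ Set.Icc b (max b b') ×ˢ Set.Icc (min c c') c ×ˢ {p} ×ˢ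
      Set.Icc s (max s s')
    set B' := Set.Icc a' (max a a') ×ˢ Set.Icc b' (max b b') ×ˢ Set.Icc (min c c') c' ×ˢ {p'} ×ˢ
      Set.Icc s' (max s s')
    set L : Set (ℝ≥0 × ℝ≥0 × ℝ≥0 × ℝ≥0 × ℝ≥0) :=
      {max a a'} ×ˢ {max b b'} ×ˢ {min c c'} ×ˢ Set.Icc p p' ×ˢ {max s s'}
    have hBL : (max a a', max b b', min c c', p, max s s') ∈ B := by simp [B]
    have hBL' : (max a a', max b b', min c c', p', max s s') ∈ B' := by simp [B']
    have hL : IsPreconnected L := isPreconnected_singleton.prod (isPreconnected_singleton.prod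
      (isPreconnected_singleton.prod (isPreconnected_Icc.prod isPreconnected_singleton)))
    have hBC : B ⊆ connectivityRegion := hmono hq
    have hBC' : B' ⊆ connectivityRegion := hmono hq'
    refine ⟨B ∪ L ∪ B', Set.union_subset (Set.union_subset ?_ ?_) ?_, Or.inl (Or.inl ?_),
      Or.inr ?_, ?_⟩
    · exact fun r hr => ⟨hBC hr, hS₁.out ha hA hr.1, hS₂.out hb hB hr.2.1,
        hS₃.out hC hc hr.2.2.1, trivial⟩
    · rintro ⟨x, y, z, u, v⟩ ⟨h1, h2, h3, h4, h5⟩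
      simp only [Set.mem_singleton_iff] at h1 h2 h3 h5
      subst h1 h2 h3 h5
      exact ⟨SimultaneouslyConnected.of_primaryDensity_between h4.1 h4.2 (hBC hBL) (hBC' hBL'),
        hA, hB, hC, trivial⟩
    · exact fun r hr => ⟨hBC' hr, hS₁.out ha' hA hr.1, hS₂.out hb' hB hr.2.1,
        hS₃.out hC hc' hr.2.2.1, trivial⟩
    · simp [B]
    · simp [B']
    · exact (hbox.union (max a a', max b b', min c c', p, max s s') hBL (by simp [L, hpp]) hL).union
        (max a a', max b b', min c c', p', max s s') (Or.inr (by simp [L, hpp])) hBL' hbox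
  refine isPreconnected_of_forall_pair fun q hq q' hq' => ?_
  rcases le_total q.2.2.2.1 q'.2.2.2.1 with h | h
  · exact key q hq q' hq' h
  · obtain ⟨t, ht, h1, h2, h3⟩ := key q' hq' q hq h
    exact ⟨t, ht, h2, h1, h3⟩

theorem mainTheorem8 :
    IsPreconnected connectivityRegion ∧
    (∀ Dt dt Df : ℝ≥0, IsPreconnected (connectivityRegion₃ Dt dt Df)) ∧
    (∀ Dt dt : ℝ≥0, IsPreconnected (connectivityRegion₂ Dt dt)) ∧
    (∀ Dt : ℝ≥0, IsPreconnected (connectivityRegion₁ Dt)) := by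
  refine ⟨?_, fun Dt dt Df => ?_, fun Dt dt => ?_, fun Dt => ?_⟩
  · have := isPreconnected_connectivityRegion_inter Set.ordConnected_univ Set.ordConnected_univ
      Set.ordConnected_univ
    simpa using this
  -- A section is the image, under a continuous projection, of the slice where the fixed coordinates
  -- range over singletons.
  · have := isPreconnected_connectivityRegion_inter (Set.ordConnected_singleton (a := Dt))
      (Set.ordConnected_singleton (a := dt)) (Set.ordConnected_singleton (a := Df))
    convert this.image (fun q => q.2.2.2) (by fun_prop)
    ext q
    constructor
    · exact fun hq => ⟨(Dt, dt, Df, q), ⟨hq, rfl, rfl, rfl, trivial⟩, rfl⟩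
    · rintro ⟨⟨_, _, _, _⟩, ⟨hq, rfl, rfl, rfl, -⟩, rfl⟩
      exact hq
  · have := isPreconnected_connectivityRegion_inter (Set.ordConnected_singleton (a := Dt))
      (Set.ordConnected_singleton (a := dt)) Set.ordConnected_univ
    convert this.image (fun q => q.2.2) (by fun_prop)
    ext q
    constructor
    · exact fun hq => ⟨(Dt, dt, q), ⟨hq, rfl, rfl, trivial, trivial⟩, rfl⟩
    · rintro ⟨⟨_, _, _⟩, ⟨hq, rfl, rfl, -⟩, rfl⟩
      exact hq
  · have := isPreconnected_connectivityRegion_inter (Set.ordConnected_singleton (a := Dt))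
      Set.ordConnected_univ Set.ordConnected_univ
    convert this.image (fun q => q.2) (by fun_prop)
    ext q
    constructor
    · exact fun hq => ⟨(Dt, q), ⟨hq, rfl, trivial, trivial, trivial⟩, rfl⟩
    · rintro ⟨⟨_, _⟩, ⟨hq, rfl, -⟩, rfl⟩
      exact hq
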